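/- Let $N=(N_1,\ldots,N_r)$ be integers $\geq 2$, and for any such sequence put $M=N_1\cdots N_r$. Let $e_1,\ldots,e_M$ be the monomials in $r$ variables of degree at most $N_i-1$ in the $i$-th variable for every $i$, ordered first by increasing total degree and, within each degree, lexicographically (so that the order begins $1,z^{(1)},z^{(2)},\ldots$). For vectors $\underline z_1,\ldots,\underline z_M$ of length $r$ with entries in a commutative ring, the multivariable Vandermonde matrix is $V_N(\underline z_1,\ldots,\underline z_M)=(e_j(\underline z_i))_{i,j}$. Let $1\leq k<r$, $m=N_1\cdots N_k$ and $n=N_{k+1}\cdots N_r$, and write each vector $\underline z$ of length $r$ as $\underline z=(\underline z',\underline z'')$, where $\underline z'$ consists of the first $k$ coordinates and $\underline z''$ of the last $r-k$. A tableau of shape $n^m$ is a filling of an array with $m$ rows and $n$ columns by the numbers $1,\ldots,mn$, each used once; it is standard if all its rows and columns are increasing. Then there are integers $\Phi_{\alpha,\beta}$, indexed by pairs of standard tableaux of shape $n^m$ and depending only on $N$ and $k$, such that for every commutative ring $R$ and all $\underline z_1,\ldots,\underline z_{mn}\in R^r$, $$\det V_{(N_1,\ldots,N_r)}(\underline z_1,\ldots,\underline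 z_{mn})=\sum_{\alpha,\beta}\Phi_{\alpha,\beta}\ \prod_{i=1}^{n}\det V_{(N_1,\ldots,N_k)}\bigl(\underline z'_p,\ p\in\mathrm{col}_i(\alpha)\bigr)\ \prod_{j=1}^{m}\det V_{(N_{k+1},\ldots,N_r)}\bigl(\underline z''_p,\ p\in\mathrm{row}_j(\beta)\bigr).$$ The sum is over all pairs of standard tableaux $\alpha,\beta$ of shape $n^m$; $\mathrm{col}_i(\alpha)$ is the $i$-th column of $\alpha$ and $\mathrm{row}_j(\beta)$ the $j$-th row of $\beta$, each taken in ascending order. Moreover, up to one global sign $s\in\{\pm1\}$ (depending only on $N$ and $k$), the matrix $\Phi$ is explicit. Let $\varepsilon(\gamma)$, for a tableau $\gamma$ of shape $n^m$, be the sign of the permutation which takes the tableau filled consecutively from top to bottom and then from left to right to $\gamma$. Let $F_{\alpha,\beta}=0$ if two distinct numbers lie in a common column of $\alpha$ and a common row of $\beta$, and otherwise let $F_{\alpha,\beta}=\varepsilon(\gamma)$, where $\gamma$ is the unique tableau of shape $n^m$ each of whose columns has the same set of entries as the corresponding column of $\alpha$ and each of whose rows has the same set of entries as the corresponding row of $\beta$.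 Then $F=(F_{\alpha,\beta})$ is invertible over $\mathbb Z$, and $\Phi$ is $s$ times the inverse transpose of the matrix $\bigl(\varepsilon(\alpha)F_{\alpha,\beta}\,\varepsilon(\beta)\bigr)_{\alpha,\beta}$. -/

import Mathlib

/-- Sort key of the monomial with exponent vector `a` in the degree-lexicographic order
`1, z₁, …, z_r, z₁², z₁z₂, …`: first the total degree, increasing; then, within a degree,
the lexicographic order, in which the monomial with the larger exponent of the first variable
where they differ comes first. -/
def degLexKey {r : ℕ} (a : Fin r → ℕ) : ℕ ×ₗ (Lex (Fin r → ℕ))ᵒᵈ :=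
  toLex (∑ i, a i, OrderDual.toDual (toLex a))

theorem degLexKey_injective {r : ℕ} :
    Function.Injective (degLexKey : (Fin r → ℕ) → ℕ ×ₗ (Lex (Fin r → ℕ))ᵒᵈ) := by
  intro a b h
  have h1 := congrArg (fun p => (ofLex p).2) h
  exact h1

/-- The (keys of the) monomials of degree at most `N i - 1` in the `i`-th variable. -/
def monomialKeys {r : ℕ} (N : Fin r → ℕ) : Finset (ℕ ×ₗ (Lex (Fin r → ℕ))ᵒᵈ) :=
  (Fintype.piFinset fun i => Finset.range (N i)).map ⟨degLexKey, degLexKey_injective⟩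

theorem card_monomialKeys {r : ℕ} (N : Fin r → ℕ) : (monomialKeys N).card = ∏ i, N i := by
  simp [monomialKeys]

/-- The exponent vector of the `j`-th monomial (counted from `0`), in degree-lexicographic
order, among the `M = ∏ i, N i` monomials of degree at most `N i - 1` in the `i`-th variable. -/
noncomputable def monomialExponent {r M : ℕ} (N : Fin r → ℕ) (hM : ∏ i, N i = M) (j : Fin M) : Fin r → ℕ :=
  ofLex (OrderDual.ofDual
    (ofLex ((monomialKeys N).orderEmbOfFin ((card_monomialKeys N).trans hM) j)).2)

/-- The multivariable Vandermonde matrix `V_N(z_1, …, z_M)`, with `M = N_1 ⋯ N_r`: the entry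
in row `i` and column `j` is the `j`-th monomial evaluated at the vector `z i`. -/
noncomputable def multiVandermonde {R : Type*} [CommRing R] {r M : ℕ} (N : Fin r → ℕ) (hM : ∏ i, N i = M)
    (z : Fin M → Fin r → R) : Matrix (Fin M) (Fin M) R :=
  Matrix.of fun i j => ∏ t, z i t ^ monomialExponent N hM j t

/-- A (not necessarily standard) tableau of rectangular shape `n^m`: the numbers
`0, …, mn - 1`, each placed in one box of an array with `m` rows and `n` columns. -/
abbrev RectTableau (m n : ℕ) : Type := (Fin m × Fin n) ≃ Fin (m * n)

/-- Standard Young tableaux of shape `n^m`: the entries increase along each row and down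
each column. -/
abbrev StdTableau (m n : ℕ) : Type :=
  {T : RectTableau m n //
    (∀ i : Fin m, ∀ j j' : Fin n, j < j' → T (i, j) < T (i, j')) ∧
    (∀ j : Fin n, ∀ i i' : Fin m, i < i' → T (i, j) < T (i', j))}

/-- The tableau `1_{n^m}`, filled consecutively from top to bottom and then from left to right:
the box `(i, j)` contains `i + m * j`. -/
def trivialTableau (m n : ℕ) : RectTableau m n :=
  (Equiv.prodComm (Fin m) (Fin n)).trans
    (finProdFinEquiv.trans (finCongr (Nat.mul_comm n m)))

/-- The sign of a tableau `γ`: the sign of the permutation `π` with `π (1_{n^m}) = γ`. -/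
def tableauSign {m n : ℕ} (γ : RectTableau m n) : ℤ :=
  ((Equiv.Perm.sign ((trivialTableau m n).symm.trans γ) : ℤˣ) : ℤ)

/-- The box in the row of `x` in `β` and in the column of `x` in `α`. -/
def crossBox {m n : ℕ} (α β : RectTableau m n) (x : Fin (m * n)) : Fin m × Fin n :=
  ((β.symm x).1, (α.symm x).2)

theorem crossBox_bijective {m n : ℕ} {α β : RectTableau m n}
    (h : Function.Injective (crossBox α β)) : Function.Bijective (crossBox α β) :=
  (Fintype.bijective_iff_injective_and_card _).2 ⟨h, by simp⟩

/-- The Fayers number `⟨α, β'⟩`, where `β'` is the conjugate of `β`, so that the columns of `β'`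
are the rows of `β`. It is `0` if two numbers lie in a common column of `α` and in a common
row of `β`. Otherwise it is the sign of the unique tableau `γ` which is column-equivalent
to `α` and row-equivalent to `β` (each `x` is in the same column of `γ` as of `α`, and in the
same row of `γ` as of `β`). -/
noncomputable def fayersNumber {m n : ℕ} (α β : RectTableau m n) : ℤ :=
  open Classical in
  if h : Function.Injective (crossBox α β) then
    tableauSign (Equiv.ofBijective (crossBox α β) (crossBox_bijective h)).symm
  else 0

/-- The Fayers matrix `F` for the shape `n^m`. -/
noncomputable def fayersMatrix (m n : ℕ) : Matrix (StdTableau m n) (StdTableau m n) ℤ :=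
  Matrix.of fun α β => fayersNumber α.1 β.1

/-- The diagonal matrix of the signs of the standard tableaux. -/
def signMatrix (m n : ℕ) : Matrix (StdTableau m n) (StdTableau m n) ℤ :=
  Matrix.diagonal fun α => tableauSign α.1

/-- The inverse transpose of the matrix `(ε(α) F_{α,β} ε(β))_{α,β}`. -/
noncomputable def phiMatrix (m n : ℕ) : Matrix (StdTableau m n) (StdTableau m n) ℤ :=
  ((signMatrix m n * fayersMatrix m n * signMatrix m n)⁻¹).transpose

/-! Up to a permutation of columns, row `p` of the big Vandermonde matrix is the tensor product of
the rows `p` of two smaller ones, so the theorem is about `boxDet A B`. Expanding the rows of `A` in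
unit vectors makes `boxDet A`, as a function of `B`, a combination of terms `boxDet (wordMatrix w)`.
Garnir relations straighten these into the terms for row words of standard tableaux
(`boxDet_wordMatrix_mem_span`), which by `boxDet_row` are signed products of row minors of `B`.

The coefficients are found by testing on the column words of standard `α`: the left side becomes a
signed product of column minors of `A`, the right side the `α`-row of the Fayers matrix applied to
the coefficients. That matrix is triangular with diagonal entries `±1`, hence invertible over ℤ, and
solving gives `phiMatrix`. Straightening divides by integers, so it is done over a field of
characteristic zero; the identity then passes to every ring through generic matrices. -/

/-! ### Triangularity of the Fayers matrix -/

/-- The row of each entry of a tableau. -/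
def rowWord {m n : ℕ} (β : RectTableau m n) (p : Fin (m * n)) : Fin m := (β.symm p).1

/-- The word gives the set of entries of each row, and a standard row lists its set increasingly. -/
theorem rowWord_injective {m n : ℕ} :
    Function.Injective fun α : StdTableau m n => rowWord α.1 := by
  intro α β h
  have h' : ∀ p, (α.1.symm p).1 = (β.1.symm p).1 := fun p => congrFun h p
  apply Subtype.ext
  apply Equiv.ext
  rintro ⟨i, j⟩
  have hr : ∀ (γ : StdTableau m n), Set.range (fun j => γ.1 (i, j)) =
      {p | (γ.1.symm p).1 = i} := by
    intro γ
    ext p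
    constructor
    · rintro ⟨j, rfl⟩
      simp
    · intro hp
      refine ⟨(γ.1.symm p).2, ?_⟩
      have : (i, (γ.1.symm p).2) = γ.1.symm p := Prod.ext hp.symm rfl
      simp [this]
  have hs : ∀ γ : StdTableau m n, StrictMono (fun j => γ.1 (i, j)) := fun γ _ _ hab =>
    γ.2.1 i _ _ hab
  have := (StrictMono.range_inj (hs α) (hs β)).1 (by rw [hr, hr]; simp [h'])
  exact congrFun this j

theorem fayersNumber_self {m n : ℕ} (α : RectTableau m n) :
    fayersNumber α α = tableauSign α := by
  have h : crossBox α α = α.symm := rfl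
  have hi : Function.Injective (crossBox α α) := h ▸ α.symm.injective
  unfold fayersNumber
  rw [dif_pos hi]
  have : Equiv.ofBijective (crossBox α α) (crossBox_bijective hi) = α.symm := by
    ext x : 1
    rfl
  rw [this, Equiv.symm_symm]

theorem isUnit_tableauSign {m n : ℕ} (α : RectTableau m n) : IsUnit (tableauSign α) :=
  Units.isUnit _

theorem tableauSign_mul_self {m n : ℕ} (α : RectTableau m n) :
    tableauSign α * tableauSign α = 1 := by
  unfold tableauSign
  rw [← Units.val_mul, Int.units_mul_self, Units.val_one]

theorem fayersNumber_eq_zero {m n : ℕ} {α β : StdTableau m n}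
    (h : toLex (rowWord β.1) < toLex (rowWord α.1)) : fayersNumber α.1 β.1 = 0 := by
  unfold fayersNumber
  rw [dif_neg]
  intro hinj
  obtain ⟨p, hp, hlt⟩ := h
  simp only [Pi.toLex_apply] at hp hlt
  -- At the first difference `p`, this entry `q` lies above `p` in its column of `α`. As `q < p`,
  -- the words agree at `q`, so `q` and `p` also share a row of `β`.
  have hq : α.1 (rowWord β.1 p, (α.1.symm p).2) < p := by
    have := α.2.2 (α.1.symm p).2 _ _ hlt
    simpa [rowWord] using this
  have hrow := hp _ hq
  refine hq.ne (hinj ?_)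
  unfold crossBox
  refine Prod.ext (hrow.trans ?_) ?_ <;> simp [rowWord]

/-- The Fayers matrix is unitriangular up to signs on the diagonal. -/
theorem isUnit_fayersMatrix (m n : ℕ) : IsUnit (fayersMatrix m n) := by
  rw [Matrix.isUnit_iff_isUnit_det]
  let _ : LinearOrder (StdTableau m n) := LinearOrder.lift'
    (fun α => toLex (rowWord α.1)) (fun α β h => rowWord_injective (toLex.injective h))
  have ht : (fayersMatrix m n).BlockTriangular id := by
    intro α β h
    exact fayersNumber_eq_zero h
  have := Matrix.det_of_isUpperTriangular ht
  have h2 : IsUnit (∏ α, fayersMatrix m n α α) := by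
    rw [IsUnit.prod_iff]
    intro α _
    change IsUnit (fayersNumber α.1 α.1)
    rw [fayersNumber_self]
    exact isUnit_tableauSign _
  rw [← this] at h2
  convert h2

/-! ### Determinants of row-wise tensor products -/

/-- The determinant of the square matrix whose row `p` is the tensor product of the rows `p` of
`A` and of `B`. -/
def boxDet {R : Type*} [CommRing R] {m n : ℕ} (A : Fin (m * n) → Fin m → R)
    (B : Fin (m * n) → Fin n → R) : R :=
  (Matrix.of fun p q => A p ((trivialTableau m n).symm q).1 *
    B p ((trivialTableau m n).symm q).2).det

/-- The matrix whose `p`-th row is the unit vector at `w p`. -/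
def wordMatrix (R : Type*) [CommRing R] {M m : ℕ} (w : Fin M → Fin m) (p : Fin M) (a : Fin m) : R :=
  if w p = a then 1 else 0

section boxDet

variable {R : Type*} [CommRing R] {m n : ℕ}

theorem det_box_eq (A : Fin (m * n) → Fin m → R) (B : Fin (m * n) → Fin n → R)
    (γ : RectTableau m n) :
    (Matrix.of fun x y : Fin m × Fin n => A (γ x) y.1 * B (γ x) y.2).det =
      (tableauSign γ : R) * boxDet A B := by
  unfold boxDet tableauSign
  rw [← Matrix.det_permute, ← Matrix.det_submatrix_equiv_self (trivialTableau m n)]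
  congr 1
  ext x y
  simp

theorem boxDet_eq (A : Fin (m * n) → Fin m → R) (B : Fin (m * n) → Fin n → R)
    (γ : RectTableau m n) :
    boxDet A B = (tableauSign γ : R) *
      (Matrix.of fun x y : Fin m × Fin n => A (γ x) y.1 * B (γ x) y.2).det := by
  rw [det_box_eq, ← mul_assoc, ← Int.cast_mul, tableauSign_mul_self, Int.cast_one, one_mul]

/-- Listing the rows in the order given by `α` makes the matrix block diagonal, with one block for
each column of `α`. -/
theorem boxDet_column (A : Fin (m * n) → Fin m → R) (α : RectTableau m n) :
    boxDet A (wordMatrix R fun p => (α.symm p).2) =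
      (tableauSign α : R) * ∏ i : Fin n, (Matrix.of fun a j => A (α (a, i)) j).det := by
  rw [boxDet_eq _ _ α, ← Matrix.det_blockDiagonal]
  congr 2
  ext x y
  simp [wordMatrix, Matrix.blockDiagonal_apply]

theorem boxDet_row (B : Fin (m * n) → Fin n → R) (β : RectTableau m n) :
    boxDet (wordMatrix R (rowWord β)) B =
      (tableauSign β : R) * ∏ i : Fin m, (Matrix.of fun a j => B (β (i, a)) j).det := by
  rw [boxDet_eq _ _ β, ← Matrix.det_blockDiagonal,
    ← Matrix.det_submatrix_equiv_self (Equiv.prodComm (Fin n) (Fin m))]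
  congr 2
  ext x y
  simp [wordMatrix, rowWord, Matrix.blockDiagonal_apply]
  rfl

/-- Row `p` is the unit vector at `crossBox α β p`: either two rows coincide, or the matrix is a
permutation matrix. -/
theorem boxDet_row_column (α β : RectTableau m n) :
    boxDet (wordMatrix R (rowWord β)) (wordMatrix R fun p => (α.symm p).2) =
      (fayersNumber α β : R) := by
  unfold fayersNumber
  split_ifs with h
  · rw [boxDet_eq _ _ (Equiv.ofBijective (crossBox α β) (crossBox_bijective h)).symm]
    set γ := (Equiv.ofBijective (crossBox α β) (crossBox_bijective h)).symm with hγ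
    have hx : ∀ x, (rowWord β (γ x), (α.symm (γ x)).2) = x := fun x =>
      (Equiv.ofBijective (crossBox α β) (crossBox_bijective h)).apply_symm_apply x
    have : (Matrix.of fun x y : Fin m × Fin n => wordMatrix R (rowWord β) (γ x) y.1 *
        wordMatrix R (fun p => (α.symm p).2) (γ x) y.2) = 1 := by
      ext x y
      have h1 := congrArg Prod.fst (hx x)
      have h2 := congrArg Prod.snd (hx x)
      simp only at h1 h2
      simp only [wordMatrix, Matrix.of_apply, h1, h2, Matrix.one_apply, Prod.ext_iff]
      split_ifs <;> simp_all
    rw [this, Matrix.det_one, mul_one]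
  · simp only [Function.Injective, not_forall] at h
    obtain ⟨p, q, hpq, hne⟩ := h
    rw [Int.cast_zero]
    refine Matrix.det_zero_of_row_eq hne ?_
    have h1 : rowWord β p = rowWord β q := (Prod.ext_iff.1 hpq).1
    have h2 : (α.symm p).2 = (α.symm q).2 := (Prod.ext_iff.1 hpq).2
    ext x
    simp only [wordMatrix, Matrix.of_apply]
    rw [h1]
    congr 2
    rw [h2]

theorem boxDet_comp_perm (A : Fin (m * n) → Fin m → R) (B : Fin (m * n) → Fin n → R)
    (σ : Equiv.Perm (Fin (m * n))) :
    boxDet (A ∘ σ) (B ∘ σ) = ((Equiv.Perm.sign σ : ℤˣ) : ℤ) * boxDet A B := by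
  unfold boxDet
  rw [← Matrix.det_permute]
  rfl

theorem map_boxDet {S : Type*} [CommRing S] (f : R →+* S) (A : Fin (m * n) → Fin m → R)
    (B : Fin (m * n) → Fin n → R) :
    f (boxDet A B) = boxDet (fun p a => f (A p a)) (fun p a => f (B p a)) := by
  unfold boxDet
  rw [RingHom.map_det]
  congr 1
  ext
  simp

/-- `boxDet` as a multilinear map in the rows of the second matrix. -/
def boxDetMultilinear (A : Fin (m * n) → Fin m → R) :
    MultilinearMap R (fun _ : Fin (m * n) => Fin n → R) R :=
  (Matrix.detRowAlternating (n := Fin (m * n)) (R := R)).toMultilinearMap.compLinearMap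
    fun p => LinearMap.pi fun q =>
      A p ((trivialTableau m n).symm q).1 • LinearMap.proj ((trivialTableau m n).symm q).2

theorem boxDetMultilinear_apply (A : Fin (m * n) → Fin m → R) (B : Fin (m * n) → Fin n → R) :
    boxDetMultilinear A B = boxDet A B := rfl

theorem boxDet_eq_sum_words (A : Fin (m * n) → Fin m → R) (B : Fin (m * n) → Fin n → R) :
    boxDet A B = ∑ w : Fin (m * n) → Fin m,
      (∏ p, A p (w p)) * boxDet (wordMatrix R w) B := by
  let D : MultilinearMap R (fun _ : Fin (m * n) => Fin (m * n) → R) R :=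
    (Matrix.detRowAlternating (n := Fin (m * n)) (R := R)).toMultilinearMap
  let g : Fin (m * n) → Fin m → Fin (m * n) → R := fun p a q =>
    (if a = ((trivialTableau m n).symm q).1 then 1 else 0) * B p ((trivialTableau m n).symm q).2
  have h1 : boxDet A B = D (fun p => ∑ a, A p a • g p a) := by
    change D _ = D _
    congr 1
    ext p q
    simp [g, Finset.sum_apply]
  rw [h1, MultilinearMap.map_sum]
  refine Finset.sum_congr rfl fun w _ => ?_
  rw [MultilinearMap.map_smul_univ]
  rfl

theorem alternatingMap_eq_zero_of_card_lt {ι : Type*} [Finite ι] {n : ℕ} (hn : n < Nat.card ι)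
    (g : (Fin n → R) [⋀^ι]→ₗ[R] R) : g = 0 := by
  have := Fintype.ofFinite ι
  refine Module.Basis.ext_alternating (Pi.basisFun R (Fin n)) fun v hv => ?_
  have := Fintype.card_le_of_injective v hv
  simp at this hn
  omega

/-- The Garnir relation. -/
theorem sum_boxDet_comp_perm_eq_zero (A : Fin (m * n) → Fin m → R)
    (B : Fin (m * n) → Fin n → R) (X : Finset (Fin (m * n))) (hX : n < X.card) :
    ∑ σ : Equiv.Perm {p // p ∈ X}, boxDet (A ∘ Equiv.Perm.ofSubtype σ) B = 0 := by
  -- With the rows of `B` outside `X` frozen, alternating over `X` gives an alternating form in more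
  -- than `n` vectors of `R^n`, which vanishes.
  let f := (boxDetMultilinear A).domDomRestrict (fun p => p ∈ X) (fun p => B p.1)
  have h0 := alternatingMap_eq_zero_of_card_lt (by simpa using hX) (MultilinearMap.alternatization f)
  have h1 := congrArg (fun g => g (fun p : {p // p ∈ X} => B p.1)) h0
  simp only [MultilinearMap.alternatization_apply, AlternatingMap.zero_apply] at h1
  rw [← h1, ← Equiv.sum_comp (Equiv.inv _)]
  refine Finset.sum_congr rfl fun σ _ => ?_
  have h2 : MultilinearMap.domDomCongr σ f (fun p => B p.1) =
      boxDet A (B ∘ Equiv.Perm.ofSubtype σ) := by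
    rw [MultilinearMap.domDomCongr_apply, MultilinearMap.domDomRestrict_apply,
      boxDetMultilinear_apply]
    congr 1
    funext p
    split_ifs with hp
    · simp [Equiv.Perm.ofSubtype_apply_of_mem _ hp]
    · simp [Equiv.Perm.ofSubtype_apply_of_not_mem _ hp]
  rw [h2]
  -- Moving the permutation from `B` to `A` inverts it and costs its sign, which cancels the sign in
  -- the alternatization.
  have h3 := boxDet_comp_perm (A ∘ Equiv.Perm.ofSubtype σ⁻¹) B (Equiv.Perm.ofSubtype σ)
  have h4 : (A ∘ Equiv.Perm.ofSubtype σ⁻¹) ∘ (Equiv.Perm.ofSubtype σ) = A := by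
    funext p
    simp
  rw [h4] at h3
  rw [h3, Equiv.Perm.sign_ofSubtype, Equiv.inv_apply]
  rw [Units.smul_def, zsmul_eq_mul, ← mul_assoc, ← Int.cast_mul, ← Units.val_mul,
    Int.units_mul_self]
  simp

end boxDet

/-! ### Ballot words and standard tableaux -/

open Finset in
/-- A word in which each letter occurs `n` times and all of whose prefixes contain each letter
at least as often as any larger one is the row word of a standard tableau. -/
theorem exists_stdTableau_rowWord {m n : ℕ} (w : Fin (m * n) → Fin m)
    (hc : ∀ i, #{p | w p = i} ≤ n)
    (hb : ∀ i i' : Fin m, i < i' → ∀ t, #{p | p ≤ t ∧ w p = i'} ≤ #{p | p ≤ t ∧ w p = i}) :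
    ∃ β : StdTableau m n, rowWord β.1 = w := by
  have hlt : ∀ p, #{q | q < p ∧ w q = w p} < n := by
    intro p
    refine lt_of_lt_of_le (card_lt_card ?_) (hc (w p))
    rw [ssubset_iff_of_subset (fun q => by simp)]
    exact ⟨p, by simp, by simp⟩
  -- The column of `p` is the number of earlier occurrences of its letter.
  let f : Fin (m * n) → Fin m × Fin n := fun p => (w p, ⟨_, hlt p⟩)
  have key : ∀ p p', p < p' → w p = w p' →
      #{q | q < p ∧ w q = w p} < #{q | q < p' ∧ w q = w p'} := by
    intro p p' hp hw
    refine card_lt_card ?_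
    rw [ssubset_iff_of_subset ?_]
    · exact ⟨p, by simp [hp, hw], by simp⟩
    · intro q
      simp only [mem_filter, mem_univ, true_and, hw]
      exact fun h => ⟨h.1.trans hp, h.2⟩
  have hinj : Function.Injective f := by
    intro p p' h
    have h1 : w p = w p' := (Prod.ext_iff.1 h).1
    have h2 : #{q | q < p ∧ w q = w p} = #{q | q < p' ∧ w q = w p'} :=
      congrArg Fin.val (Prod.ext_iff.1 h).2
    rcases lt_trichotomy p p' with hl | hl | hl
    · exact absurd h2 (key _ _ hl h1).ne
    · exact hl
    · exact absurd h2 (key _ _ hl h1.symm).ne'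
  let e := Equiv.ofBijective f ((Fintype.bijective_iff_injective_and_card f).2 ⟨hinj, by simp⟩)
  have he : ∀ i j, w (e.symm (i, j)) = i ∧
      #{q | q < e.symm (i, j) ∧ w q = w (e.symm (i, j))} = (j : ℕ) := by
    intro i j
    have h : f (e.symm (i, j)) = (i, j) := e.apply_symm_apply (i, j)
    exact ⟨(Prod.ext_iff.1 h).1, congrArg Fin.val (Prod.ext_iff.1 h).2⟩
  refine ⟨⟨e.symm, ?_, ?_⟩, ?_⟩
  · intro i j j' hj
    obtain ⟨h1, h2⟩ := he i j
    obtain ⟨h1', h2'⟩ := he i j'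
    by_contra! hle
    rcases hle.lt_or_eq with hl | hl
    · have := key _ _ hl (h1'.trans h1.symm)
      omega
    · rw [hl, h2] at h2'
      omega
  · intro j i i' hi
    obtain ⟨h1, h2⟩ := he i j
    obtain ⟨h1', h2'⟩ := he i' j
    set p := e.symm (i, j)
    set p' := e.symm (i', j)
    by_contra! hle
    rcases hle.lt_or_eq with hl | hl
    -- If `p' < p`, the prefix ending at `p'` has at least `j + 1` letters `i'` but at most `j`
    -- letters `i`.
    · have hb' := hb i i' hi p'
      have h3 : #{q | q ≤ p' ∧ w q = i} ≤ #{q | q < p ∧ w q = w p} := by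
        refine card_le_card fun q => ?_
        simp only [mem_filter, mem_univ, true_and, h1]
        exact fun h => ⟨h.1.trans_lt hl, h.2⟩
      have h4 : #{q | q < p' ∧ w q = w p'} < #{q | q ≤ p' ∧ w q = i'} := by
        refine card_lt_card ?_
        rw [ssubset_iff_of_subset ?_]
        · exact ⟨p', by simp [h1'], by simp⟩
        · intro q
          simp only [mem_filter, mem_univ, true_and, h1']
          exact fun h => ⟨h.1.le, h.2⟩
      omega
    · rw [hl, h1] at h1'
      exact hi.ne h1'
  · funext p
    change (f p).1 = _
    rfl

/-! ### Straightening by Garnir relations -/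

section straightening

variable {K : Type*} [Field K] [CharZero K] {m n : ℕ}

/-- In the Garnir relation the permutations fixing `w` contribute a positive integer multiple of the
wanted term; characteristic zero allows dividing by it. -/
theorem boxDet_mem_of_garnir (S : Submodule K ((Fin (m * n) → Fin n → K) → K))
    (w : Fin (m * n) → Fin m) (X : Finset (Fin (m * n))) (hX : n < X.card)
    (h : ∀ σ : Equiv.Perm {p // p ∈ X}, w ∘ Equiv.Perm.ofSubtype σ ≠ w →
      boxDet (wordMatrix K (w ∘ Equiv.Perm.ofSubtype σ)) ∈ S) :
    boxDet (wordMatrix K w) ∈ S := by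
  classical
  have h0 : ∑ σ : Equiv.Perm {p // p ∈ X},
      boxDet (n := n) (wordMatrix K (w ∘ Equiv.Perm.ofSubtype σ)) = 0 := by
    funext B
    rw [Finset.sum_apply]
    exact sum_boxDet_comp_perm_eq_zero (wordMatrix K w) B X hX
  rw [← Finset.sum_filter_add_sum_filter_not _
    (fun σ : Equiv.Perm {p // p ∈ X} => w ∘ Equiv.Perm.ofSubtype σ = w)] at h0
  have h1 : ∑ σ : Equiv.Perm {p // p ∈ X} with w ∘ Equiv.Perm.ofSubtype σ = w,
      boxDet (n := n) (wordMatrix K (w ∘ Equiv.Perm.ofSubtype σ)) =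
      ((Finset.univ.filter fun σ : Equiv.Perm {p // p ∈ X} =>
        w ∘ Equiv.Perm.ofSubtype σ = w).card : K) • boxDet (wordMatrix K w) := by
    rw [Nat.cast_smul_eq_nsmul, ← Finset.sum_const]
    refine Finset.sum_congr rfl fun σ hσ => ?_
    rw [(Finset.mem_filter.1 hσ).2]
  rw [h1] at h0
  have hne : ((Finset.univ.filter fun σ : Equiv.Perm {p // p ∈ X} =>
        w ∘ Equiv.Perm.ofSubtype σ = w).card : K) ≠ 0 := by
    rw [Nat.cast_ne_zero]
    refine Finset.card_ne_zero_of_mem (a := 1) ?_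
    simp
  rw [← Submodule.smul_mem_iff S hne, eq_neg_of_add_eq_zero_left h0]
  refine S.neg_mem (S.sum_mem fun σ hσ => h σ (Finset.mem_filter.1 hσ).2)

/-- The sum which decreases when letters of a word are rearranged increasingly. -/
def wordWeight {M m : ℕ} (w : Fin M → Fin m) : ℕ := ∑ p, (M - p) * w p

theorem wordWeight_lt {M m : ℕ} (w : Fin M → Fin m) {i i' : Fin m} (hi : i < i') (t : Fin M)
    (X : Finset (Fin M)) (hX : ∀ p ∈ X, p ≤ t ∧ w p = i' ∨ t < p ∧ w p = i)
    (σ : Equiv.Perm {p // p ∈ X}) (hσ : w ∘ Equiv.Perm.ofSubtype σ ≠ w) :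
    wordWeight (w ∘ Equiv.Perm.ofSubtype σ) < wordWeight w := by
  set v := w ∘ Equiv.Perm.ofSubtype σ with hv
  have hsum : ∑ p, (v p : ℤ) = ∑ p, (w p : ℤ) :=
    Equiv.sum_comp (Equiv.Perm.ofSubtype σ) fun p => ((w p : ℕ) : ℤ)
  have hout : ∀ p, p ∉ X → v p = w p := fun p hp => by
    simp [hv, Equiv.Perm.ofSubtype_apply_of_not_mem _ hp]
  have hin : ∀ p ∈ X, v p = i ∨ v p = i' := by
    intro p hp
    have : Equiv.Perm.ofSubtype σ p ∈ X := by
      rw [Equiv.Perm.ofSubtype_apply_of_mem _ hp]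
      exact (σ _).2
    rcases hX _ this with h | h
    · exact Or.inr h.2
    · exact Or.inl h.2
  have hi' : (i : ℤ) < i' := by exact_mod_cast hi
  -- Since the letter sum is preserved, positions may be measured from `t + 1/2`; doubling keeps
  -- them integral. Letters can only drop up to `t` and rise after it.
  have hpos : ∀ p : Fin M, 0 ≤ (2 * (p : ℤ) - 2 * t - 1) * ((v p : ℤ) - w p) ∧
      (v p ≠ w p → 0 < (2 * (p : ℤ) - 2 * t - 1) * ((v p : ℤ) - w p)) := by
    intro p
    by_cases hp : p ∈ X
    · rcases hX p hp with ⟨h1, h2⟩ | ⟨h1, h2⟩ <;> rcases hin p hp with h3 | h3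
      · have h1' : (p : ℤ) ≤ t := by exact_mod_cast h1
        have : 0 < (2 * (p : ℤ) - 2 * t - 1) * ((v p : ℤ) - w p) := by
          rw [h2, h3]
          exact mul_pos_of_neg_of_neg (by linarith) (by linarith)
        exact ⟨this.le, fun _ => this⟩
      · simp [h2, h3]
      · simp [h2, h3]
      · have h1' : (t : ℤ) + 1 ≤ p := by exact_mod_cast h1
        have : 0 < (2 * (p : ℤ) - 2 * t - 1) * ((v p : ℤ) - w p) := by
          rw [h2, h3]
          exact mul_pos (by linarith) (by linarith)
        exact ⟨this.le, fun _ => this⟩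
    · simp [hout p hp]
  have hlt : 0 < ∑ p : Fin M, (2 * (p : ℤ) - 2 * t - 1) * ((v p : ℤ) - w p) := by
    obtain ⟨p, hp⟩ := Function.ne_iff.1 hσ
    exact Finset.sum_pos' (fun p _ => (hpos p).1) ⟨p, Finset.mem_univ _, (hpos p).2 hp⟩
  have hw : ∀ u : Fin M → Fin m, (wordWeight u : ℤ) = ∑ p : Fin M, ((M : ℤ) - p) * u p := by
    intro u
    unfold wordWeight
    rw [Nat.cast_sum]
    refine Finset.sum_congr rfl fun p _ => ?_
    rw [Nat.cast_mul, Nat.cast_sub p.2.le]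
  have h2 : ∑ p : Fin M, (2 * (p : ℤ) - 2 * t - 1) * ((v p : ℤ) - w p) =
      2 * (wordWeight w : ℤ) - 2 * wordWeight v +
        (2 * (M : ℤ) - 2 * t - 1) * (∑ p, (v p : ℤ) - ∑ p, (w p : ℤ)) := by
    rw [hw, hw, Finset.mul_sum, Finset.mul_sum, ← Finset.sum_sub_distrib,
      ← Finset.sum_sub_distrib, Finset.mul_sum, ← Finset.sum_add_distrib]
    refine Finset.sum_congr rfl fun p _ => ?_
    ring
  rw [h2, hsum] at hlt
  have : (wordWeight v : ℤ) < wordWeight w := by linarith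
  exact_mod_cast this

open Finset in
/-- Straightening. -/
theorem boxDet_wordMatrix_mem_span (w : Fin (m * n) → Fin m) :
    boxDet (wordMatrix K w) ∈ Submodule.span K (Set.range fun β : StdTableau m n =>
      boxDet (n := n) (wordMatrix K (rowWord β.1))) := by
  induction hN : wordWeight w using Nat.strong_induction_on generalizing w with
  | _ N ih =>
  subst hN
  by_cases hc : ∀ i, #{p | w p = i} ≤ n
  · by_cases hb : ∀ i i' : Fin m, i < i' →
        ∀ t, #{p | p ≤ t ∧ w p = i'} ≤ #{p | p ≤ t ∧ w p = i}
    · obtain ⟨β, rfl⟩ := exists_stdTableau_rowWord w hc hb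
      exact Submodule.subset_span ⟨β, rfl⟩
    · push Not at hb
      obtain ⟨i, i', hi, t, ht⟩ := hb
      -- Every letter occurs exactly `n` times, so the failure of the ballot condition at `t` gives
      -- this set more than `n` elements.
      have hX : ∀ p ∈ (univ.filter (fun p => p ≤ t ∧ w p = i') ∪ univ.filter (fun p => t < p ∧ w p = i)),
          p ≤ t ∧ w p = i' ∨ t < p ∧ w p = i := by
        intro p hp
        simpa using hp
      refine boxDet_mem_of_garnir _ w _ ?_ fun σ hσ =>
        ih _ (wordWeight_lt w hi t _ hX σ hσ) _ rfl
      rw [card_union_of_disjoint]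
      · have hcard : ∀ i, #{p | w p = i} = n := by
          have hs : ∑ i, #{p | w p = i} = ∑ _i : Fin m, n := by
            rw [← card_eq_sum_card_fiberwise (f := w) (t := univ) (s := univ) (by simp)]
            simp
          intro i
          exact (sum_eq_sum_iff_of_le fun i _ => hc i).1 hs i (mem_univ i)
        have h1 := hcard i
        rw [← card_filter_add_card_filter_not (fun p => p ≤ t), filter_filter, filter_filter] at h1
        simp only [not_le, and_comm (a := w _ = i)] at h1
        omega
      · rw [disjoint_left]
        intro p
        simp only [mem_filter, mem_univ, true_and]
        intro h1 h2
        exact absurd h1.1 (not_le.2 h2.1)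
  · push Not at hc
    obtain ⟨i, hi⟩ := hc
    -- Permuting positions of a single letter fixes `w`, so no other term occurs.
    refine boxDet_mem_of_garnir _ w _ hi fun σ hσ => absurd ?_ hσ
    funext p
    by_cases hp : p ∈ ({p | w p = i} : Finset (Fin (m * n)))
    · have h2 := (σ ⟨p, hp⟩).2
      rw [Function.comp_apply, Equiv.Perm.ofSubtype_apply_of_mem _ hp]
      rw [mem_filter] at hp h2
      rw [hp.2, h2.2]
    · simp [Equiv.Perm.ofSubtype_apply_of_not_mem _ hp]

end straightening

/-! ### The expansion over an arbitrary ring -/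

theorem signMatrix_mul_self (m n : ℕ) : signMatrix m n * signMatrix m n = 1 := by
  unfold signMatrix
  rw [Matrix.diagonal_mul_diagonal]
  simp [tableauSign_mul_self]

theorem phiMatrix_apply {m n : ℕ} (α β : StdTableau m n) :
    phiMatrix m n α β = tableauSign β.1 * (fayersMatrix m n)⁻¹ β α * tableauSign α.1 := by
  have h : (signMatrix m n)⁻¹ = signMatrix m n :=
    Matrix.inv_eq_left_inv (signMatrix_mul_self m n)
  unfold phiMatrix
  rw [Matrix.transpose_apply, Matrix.mul_inv_rev, Matrix.mul_inv_rev, h, ← mul_assoc]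
  unfold signMatrix
  rw [Matrix.mul_diagonal, Matrix.diagonal_mul]

/-- The expansion of the determinant of a row-wise tensor product in products of determinants
of the factors. -/
def BoxDetExpansion {R : Type*} [CommRing R] {m n : ℕ} (A : Fin (m * n) → Fin m → R)
    (B : Fin (m * n) → Fin n → R) : Prop :=
  boxDet A B = ∑ α : StdTableau m n, ∑ β : StdTableau m n, (phiMatrix m n α β : R) *
    (∏ i : Fin n, (Matrix.of fun a j => A (α.1 (a, i)) j).det) *
    (∏ i : Fin m, (Matrix.of fun a j => B (β.1 (i, a)) j).det)

theorem boxDetExpansion_of_field {K : Type*} [Field K] [CharZero K] {m n : ℕ}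
    (A : Fin (m * n) → Fin m → K) (B : Fin (m * n) → Fin n → K) : BoxDetExpansion A B := by
  have hmem : boxDet A ∈ Submodule.span K (Set.range fun β : StdTableau m n =>
      boxDet (n := n) (wordMatrix K (rowWord β.1))) := by
    have : boxDet (n := n) A = ∑ w : Fin (m * n) → Fin m,
        (∏ p, A p (w p)) • boxDet (wordMatrix K w) := by
      funext B
      rw [boxDet_eq_sum_words, Finset.sum_apply]
      rfl
    rw [this]
    exact Submodule.sum_mem _ fun w _ =>
      Submodule.smul_mem _ _ (boxDet_wordMatrix_mem_span w)
  obtain ⟨g, hg⟩ := (Submodule.mem_span_range_iff_exists_fun K).1 hmem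
  have hg' : ∀ B, boxDet A B = ∑ β, g β * boxDet (wordMatrix K (rowWord β.1)) B := by
    intro B
    rw [← hg, Finset.sum_apply]
    rfl
  -- Testing on the column word of `α` gives a linear system for `g` with the Fayers matrix.
  have hU : ∀ α : StdTableau m n, (tableauSign α.1 : K) *
      ∏ i : Fin n, (Matrix.of fun a j => A (α.1 (a, i)) j).det =
      ∑ β, (fayersMatrix m n α β : K) * g β := by
    intro α
    rw [← boxDet_column, hg']
    refine Finset.sum_congr rfl fun β _ => ?_
    rw [boxDet_row_column, mul_comm]
    rfl
  have hF : (fayersMatrix m n)⁻¹ * fayersMatrix m n = 1 :=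
    Matrix.nonsing_inv_mul _ ((Matrix.isUnit_iff_isUnit_det _).1 (isUnit_fayersMatrix m n))
  have hgβ : ∀ β, g β = ∑ α : StdTableau m n, ((fayersMatrix m n)⁻¹ β α : K) *
      ((tableauSign α.1 : K) * ∏ i : Fin n, (Matrix.of fun a j => A (α.1 (a, i)) j).det) := by
    intro β
    simp_rw [hU, Finset.mul_sum]
    rw [Finset.sum_comm]
    have h1 : ∀ δ : StdTableau m n, ∑ α, ((fayersMatrix m n)⁻¹ β α : K) *
        ((fayersMatrix m n α δ : K) * g δ) = if β = δ then g δ else 0 := by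
      intro δ
      have h2 := congrFun (congrFun hF β) δ
      rw [Matrix.mul_apply, Matrix.one_apply] at h2
      have h3 := congrArg (Int.cast : ℤ → K) h2
      push_cast at h3
      simp_rw [← mul_assoc]
      rw [← Finset.sum_mul, h3]
      split_ifs <;> simp
    simp_rw [h1]
    simp
  unfold BoxDetExpansion
  rw [hg', Finset.sum_comm]
  refine Finset.sum_congr rfl fun β _ => ?_
  rw [hgβ, boxDet_row, Finset.sum_mul]
  refine Finset.sum_congr rfl fun α _ => ?_
  rw [phiMatrix_apply]
  push_cast
  ring

theorem map_boxDetExpansion_rhs {R S : Type*} [CommRing R] [CommRing S] (f : R →+* S) {m n : ℕ}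
    (A : Fin (m * n) → Fin m → R) (B : Fin (m * n) → Fin n → R) :
    f (∑ α : StdTableau m n, ∑ β : StdTableau m n, (phiMatrix m n α β : R) *
      (∏ i : Fin n, (Matrix.of fun a j => A (α.1 (a, i)) j).det) *
      (∏ i : Fin m, (Matrix.of fun a j => B (β.1 (i, a)) j).det)) =
    ∑ α : StdTableau m n, ∑ β : StdTableau m n, (phiMatrix m n α β : S) *
      (∏ i : Fin n, (Matrix.of fun a j => f (A (α.1 (a, i)) j)).det) *
      (∏ i : Fin m, (Matrix.of fun a j => f (B (β.1 (i, a)) j)).det) := by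
  simp only [map_sum, map_mul, map_prod, map_intCast, RingHom.map_det]
  rfl

theorem BoxDetExpansion.map {R S : Type*} [CommRing R] [CommRing S] (f : R →+* S) {m n : ℕ}
    {A : Fin (m * n) → Fin m → R} {B : Fin (m * n) → Fin n → R} (h : BoxDetExpansion A B) :
    BoxDetExpansion (fun p a => f (A p a)) (fun p a => f (B p a)) := by
  unfold BoxDetExpansion at h ⊢
  rw [← map_boxDet, h, map_boxDetExpansion_rhs]

theorem BoxDetExpansion.of_map {R S : Type*} [CommRing R] [CommRing S] {f : R →+* S}
    (hf : Function.Injective f) {m n : ℕ}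
    {A : Fin (m * n) → Fin m → R} {B : Fin (m * n) → Fin n → R}
    (h : BoxDetExpansion (fun p a => f (A p a)) (fun p a => f (B p a))) :
    BoxDetExpansion A B := by
  unfold BoxDetExpansion at h ⊢
  rw [← map_boxDet, ← map_boxDetExpansion_rhs] at h
  exact hf h

/-- Both sides are integer polynomials in the matrix entries, so it suffices to take independent
variables, in the fraction field of their polynomial ring. -/
theorem boxDetExpansion {R : Type*} [CommRing R] {m n : ℕ}
    (A : Fin (m * n) → Fin m → R) (B : Fin (m * n) → Fin n → R) : BoxDetExpansion A B := by
  let σ := (Fin (m * n) × Fin m) ⊕ (Fin (m * n) × Fin n)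
  let P := MvPolynomial σ ℤ
  let X : Fin (m * n) → Fin m → P := fun p a => MvPolynomial.X (Sum.inl (p, a))
  let Y : Fin (m * n) → Fin n → P := fun p a => MvPolynomial.X (Sum.inr (p, a))
  have : CharZero (FractionRing P) :=
    charZero_of_injective_algebraMap (IsFractionRing.injective P (FractionRing P))
  have hXY : BoxDetExpansion X Y :=
    BoxDetExpansion.of_map (IsFractionRing.injective P (FractionRing P))
      (boxDetExpansion_of_field _ _)
  have := hXY.map (MvPolynomial.eval₂Hom (Int.castRingHom R)
    (Sum.elim (fun x => A x.1 x.2) (fun x => B x.1 x.2)))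
  simpa [X, Y] using this

/-! ### Factoring monomials and the Vandermonde matrix -/

theorem monomialExponent_injective {r M : ℕ} (N : Fin r → ℕ) (hM : ∏ i, N i = M) :
    Function.Injective (monomialExponent N hM) := by
  intro i j h
  have hmem := fun j => Finset.orderEmbOfFin_mem (monomialKeys N) ((card_monomialKeys N).trans hM) j
  have hkey : ∀ j, degLexKey (monomialExponent N hM j) =
      (monomialKeys N).orderEmbOfFin ((card_monomialKeys N).trans hM) j := by
    intro j
    obtain ⟨a, _, ha⟩ := Finset.mem_map.1 (hmem j)
    unfold monomialExponent
    rw [← ha]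
    rfl
  apply ((monomialKeys N).orderEmbOfFin ((card_monomialKeys N).trans hM)).injective
  rw [← hkey, ← hkey, h]

theorem range_monomialExponent {r M : ℕ} (N : Fin r → ℕ) (hM : ∏ i, N i = M) :
    Set.range (monomialExponent N hM) = {a | ∀ t, a t < N t} := by
  ext a
  have hr := Finset.range_orderEmbOfFin (monomialKeys N) ((card_monomialKeys N).trans hM)
  constructor
  · rintro ⟨j, rfl⟩
    obtain ⟨b, hb, hj⟩ := Finset.mem_map.1
      (Finset.orderEmbOfFin_mem (monomialKeys N) ((card_monomialKeys N).trans hM) j)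
    have : monomialExponent N hM j = b := by
      unfold monomialExponent
      rw [← hj]
      rfl
    simpa [this] using hb
  · intro ha
    have : degLexKey a ∈ (monomialKeys N : Set _) :=
      Finset.mem_map.2 ⟨a, by simpa using ha, rfl⟩
    rw [← hr] at this
    obtain ⟨j, hj⟩ := this
    refine ⟨j, ?_⟩
    unfold monomialExponent
    rw [hj]
    rfl

/-- The bijection of the monomials in `k + l` variables with the pairs of monomials in the first
`k` and the last `l` variables. -/
theorem exists_monomialExponent_equiv {k l m n : ℕ} (N : Fin (k + l) → ℕ)
    (hm : ∏ i : Fin k, N (Fin.castAdd l i) = m) (hn : ∏ j : Fin l, N (Fin.natAdd k j) = n)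
    (hM : ∏ i, N i = m * n) :
    ∃ e : Fin (m * n) ≃ Fin m × Fin n, ∀ j,
      monomialExponent N hM j =
        Fin.append (monomialExponent (fun t => N (Fin.castAdd l t)) hm (e j).1)
          (monomialExponent (fun t => N (Fin.natAdd k t)) hn (e j).2) := by
  have hex : ∀ x : Fin m × Fin n, ∃ j, monomialExponent N hM j =
        Fin.append (monomialExponent (fun t => N (Fin.castAdd l t)) hm x.1)
          (monomialExponent (fun t => N (Fin.natAdd k t)) hn x.2) := by
    intro x
    have h1 := (range_monomialExponent (fun t => N (Fin.castAdd l t)) hm).le ⟨x.1, rfl⟩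
    have h2 := (range_monomialExponent (fun t => N (Fin.natAdd k t)) hn).le ⟨x.2, rfl⟩
    refine (range_monomialExponent N hM).ge fun t => ?_
    induction t using Fin.addCases with
    | left i => simpa using h1 i
    | right i => simpa using h2 i
  choose f hf using hex
  have hinj : Function.Injective f := by
    intro x y h
    have h' := (hf x).symm.trans ((congrArg _ h).trans (hf y))
    refine Prod.ext (monomialExponent_injective _ hm (funext fun i => ?_))
      (monomialExponent_injective _ hn (funext fun i => ?_))
    · simpa using congrFun h' (Fin.castAdd l i)
    · simpa using congrFun h' (Fin.natAdd k i)
  let e := Equiv.ofBijective f ((Fintype.bijective_iff_injective_and_card f).2 ⟨hinj, by simp⟩)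
  refine ⟨e.symm, fun j => ?_⟩
  rw [← hf]
  exact congrArg _ (e.apply_symm_apply j).symm

/-- The degree-lexicographic order does not respect the splitting of monomials; the sign of the
reordering of columns is the global sign `s`. -/
theorem exists_det_multiVandermonde {k l m n : ℕ} (N : Fin (k + l) → ℕ)
    (hm : ∏ i : Fin k, N (Fin.castAdd l i) = m) (hn : ∏ j : Fin l, N (Fin.natAdd k j) = n)
    (hM : ∏ i, N i = m * n) :
    ∃ s : ℤˣ, ∀ (R : Type*) [CommRing R] (z : Fin (m * n) → Fin (k + l) → R),
      (multiVandermonde N hM z).det = ((s : ℤ) : R) *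
        boxDet (fun p j => ∏ t, z p (Fin.castAdd l t) ^
            monomialExponent (fun t => N (Fin.castAdd l t)) hm j t)
          (fun p j => ∏ t, z p (Fin.natAdd k t) ^
            monomialExponent (fun t => N (Fin.natAdd k t)) hn j t) := by
  obtain ⟨e, he⟩ := exists_monomialExponent_equiv N hm hn hM
  refine ⟨Equiv.Perm.sign (e.trans (trivialTableau m n)), fun R _ z => ?_⟩
  unfold boxDet
  rw [← Matrix.det_permute']
  congr 1
  ext p j
  simp [multiVandermonde, he, Fin.prod_univ_add]

/-- Here `r = k + l`, the `i`-th column of `α` is `a ↦ α (a, i)`, and the `j`-th row of `β` is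
`b ↦ β (j, b)`; both are increasing. -/
theorem theorem1 {k l : ℕ} (hk : 1 ≤ k) (hl : 1 ≤ l)
    (N : Fin (k + l) → ℕ) (hN : ∀ i, 2 ≤ N i) (m n : ℕ)
    (hm : ∏ i : Fin k, N (Fin.castAdd l i) = m)
    (hn : ∏ j : Fin l, N (Fin.natAdd k j) = n) :
    IsUnit (fayersMatrix m n) ∧
    ∃ Φ : StdTableau m n → StdTableau m n → ℤ,
      (∃ s : ℤˣ, ∀ α β, Φ α β = s * phiMatrix m n α β) ∧
      ∀ (R : Type*) [CommRing R] (z : Fin (m * n) → Fin (k + l) → R),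
        (multiVandermonde N (by rw [Fin.prod_univ_add, hm, hn]) z).det =
          ∑ α : StdTableau m n, ∑ β : StdTableau m n, (Φ α β : R) *
            (∏ i : Fin n, (multiVandermonde (fun t => N (Fin.castAdd l t)) hm
              (fun a t => z (α.1 (a, i)) (Fin.castAdd l t))).det) *
            (∏ j : Fin m, (multiVandermonde (fun t => N (Fin.natAdd k t)) hn
              (fun b t => z (β.1 (j, b)) (Fin.natAdd k t))).det) := by
  refine ⟨isUnit_fayersMatrix m n, ?_⟩
  obtain ⟨s, hs⟩ := exists_det_multiVandermonde N hm hn (by rw [Fin.prod_univ_add, hm, hn])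
  refine ⟨fun α β => s * phiMatrix m n α β, ⟨s, fun _ _ => rfl⟩, fun R _ z => ?_⟩
  rw [hs R z, boxDetExpansion, Finset.mul_sum]
  refine Finset.sum_congr rfl fun α _ => ?_
  rw [Finset.mul_sum]
  refine Finset.sum_congr rfl fun β _ => ?_
  rw [Int.cast_mul, ← mul_assoc, ← mul_assoc]
  rfl
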